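/- **Conventions.** "Computes" refers to Kleene's schemes S1-S9. Kleene's quantifier $\exists^2:\mathbb N^{\mathbb N}\to\{0,1\}$ is given by $\exists^2(\alpha)=0$ if and only if $(\exists n)(\alpha(n)=0)$. A real is represented by a fast converging Cauchy sequence of (coded) rationals, i.e. by $(q_i)_{i\in\mathbb N}$ with limit that real and $|q_i-q_j|\le 2^{-i}$ for $i\le j$. A sequence of functions $f_n:\mathbb R\to\mathbb R$ is represented by a functional $F:\mathbb N\times\mathbb N^{\mathbb N}\to\mathbb N^{\mathbb N}$ (coded as a type 2 functional $\mathbb N^{\mathbb N}\to\mathbb N$) such that $F(n,\alpha)$ represents $f_n(x)$ whenever $\alpha$ represents $x\in\mathbb R$. An RM-code of a closed set $C\subseteq\mathbb R$ is a pair of sequences of reals $(a_n)_{n\in\mathbb N},(b_n)_{n\in\mathbb N}$ with $\mathbb R\setminus C=\bigcup_{n}(a_n,b_n)$. **Lemma.** Let $(f_n)_{n\in\mathbb N}$ be a sequence of continuous functions $f_n:\mathbb R\to\mathbb R$ with pointwise limit $f:\mathbb R\to\mathbb R$, and let $C\subseteq\mathbb R$ be a non-empty closed set given by an RM-code. Then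 $\exists^2$ computes a point $x\in C$ at which the restriction $f_{\upharpoonright C}:C\to\mathbb R$ is continuous, in terms of the sequence $(f_n)_{n\in\mathbb N}$ and the RM-code of $C$. That is, there is one Kleene index $e$ such that for all $(f_n)_{n\in\mathbb N}$, $f$, $C$ and all RM-codes $(a_n)_{n\in\mathbb N},(b_n)_{n\in\mathbb N}$ of $C$ as above, there is a point $x\in C$ at which $f_{\upharpoonright C}$ is continuous and such that, for all representations $F$ of $(f_n)_{n\in\mathbb N}$, $A$ of $(a_n)_{n\in\mathbb N}$ and $B$ of $(b_n)_{n\in\mathbb N}$, the computation $\{e\}(k,\exists^2,F,A,B)$ terminates for every $k\in\mathbb N$ and $k\mapsto\{e\}(k,\exists^2,F,A,B)$ represents $x$. -/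

import Mathlib

open Set Filter Topology

/-! ### Kleene's higher-order computability (schemes S1-S9) -/

/-- The pure types: type `0` is `ℕ`, and objects of type `j + 1` are the total maps from
objects of type `j` to `ℕ`. -/
def PureType : ℕ → Type
  | 0 => ℕ
  | j + 1 => PureType j → ℕ

/-- An argument of a Kleene computation: an object of some pure type. -/
abbrev KArg : Type := Σ j : ℕ, PureType j

/-- A natural number as an argument of type `0`. -/
def KArg.num (n : ℕ) : KArg := ⟨0, n⟩

/-- An element of Baire space as an argument of type `1`. -/
def KArg.fn (α : ℕ → ℕ) : KArg := ⟨1, α⟩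

/-- A functional whose type is at least `2`, as an argument. -/
def KArg.functional {j : ℕ} (Φ : (PureType j → ℕ) → ℕ) : KArg := ⟨j + 2, Φ⟩

/-- A map from Baire space to `ℕ` as an argument of type `2`. -/
def KArg.fn2 (Y : (ℕ → ℕ) → ℕ) : KArg := KArg.functional (j := 0) Y

/-- `KleeneComputes e args v` says `{e}(args) ≃ v`: the Kleene computation with index `e` on the
finite list of arguments `args` terminates with value `v`. It is the least relation closed under
S1-S9. An index is a number `⟨i, …⟩`, where `i` is the number of the scheme. The
premise of S8 requires that the functional which is fed into `Φ` is total. The permutations of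
the arguments are generated, as in Kleene's own version of S6, by moving one argument to the
front. -/
inductive KleeneComputes : ℕ → List KArg → ℕ → Prop
  /-- successor: `{⟨1⟩}(x, …) = x + 1` -/
  | S1 (x : ℕ) (l : List KArg) :
      KleeneComputes (Nat.pair 1 0) (KArg.num x :: l) (x + 1)
  /-- constants: `{⟨2, q⟩}(…) = q` -/
  | S2 (q : ℕ) (l : List KArg) :
      KleeneComputes (Nat.pair 2 q) l q
  /-- projection: `{⟨3⟩}(x, …) = x` -/
  | S3 (x : ℕ) (l : List KArg) :
      KleeneComputes (Nat.pair 3 0) (KArg.num x :: l) x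
  /-- composition: `{⟨4, d, c⟩}(l) = {d}({c}(l), l)` -/
  | S4 (d c : ℕ) (l : List KArg) (u v : ℕ) :
      KleeneComputes c l u →
      KleeneComputes d (KArg.num u :: l) v →
      KleeneComputes (Nat.pair 4 (Nat.pair d c)) l v
  /-- primitive recursion: `{⟨5, d, c⟩}(0, l) = {d}(l)` -/
  | S5_zero (d c : ℕ) (l : List KArg) (v : ℕ) :
      KleeneComputes d l v →
      KleeneComputes (Nat.pair 5 (Nat.pair d c)) (KArg.num 0 :: l) v
  /-- primitive recursion: `{⟨5, d, c⟩}(x + 1, l) = {c}(x, {⟨5, d, c⟩}(x, l), l)` -/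
  | S5_succ (d c x : ℕ) (l : List KArg) (u v : ℕ) :
      KleeneComputes (Nat.pair 5 (Nat.pair d c)) (KArg.num x :: l) u →
      KleeneComputes c (KArg.num x :: KArg.num u :: l) v →
      KleeneComputes (Nat.pair 5 (Nat.pair d c)) (KArg.num (x + 1) :: l) v
  /-- permutation: `{⟨6, d, k⟩}(l₁, y, l₂) = {d}(y, l₁, l₂)`, where `k` is the length of `l₁` -/
  | S6 (d : ℕ) (y : KArg) (l₁ l₂ : List KArg) (v : ℕ) :
      KleeneComputes d (y :: (l₁ ++ l₂)) v →
      KleeneComputes (Nat.pair 6 (Nat.pair d l₁.length)) (l₁ ++ y :: l₂) v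
  /-- application at type 1: `{⟨7⟩}(α, x, …) = α(x)` -/
  | S7 (α : ℕ → ℕ) (x : ℕ) (l : List KArg) :
      KleeneComputes (Nat.pair 7 0) (KArg.fn α :: KArg.num x :: l) (α x)
  /-- application at types `≥ 2`: `{⟨8, d⟩}(Φ, l) = Φ(λ y. {d}(y, Φ, l))` -/
  | S8 (d : ℕ) {j : ℕ} (Φ : (PureType j → ℕ) → ℕ) (l : List KArg) (g : PureType j → ℕ) :
      (∀ y : PureType j, KleeneComputes d (⟨j, y⟩ :: KArg.functional Φ :: l) (g y)) →
      KleeneComputes (Nat.pair 8 d) (KArg.functional Φ :: l) (Φ g)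
  /-- enumeration: `{⟨9, m⟩}(x, l₁, l₂) = {x}(l₁)`, where `m` is the length of `l₁` -/
  | S9 (x : ℕ) (l₁ l₂ : List KArg) (v : ℕ) :
      KleeneComputes x l₁ v →
      KleeneComputes (Nat.pair 9 l₁.length) (KArg.num x :: (l₁ ++ l₂)) v

open Classical in
/-- Kleene's quantifier `∃²`: it maps `α` to `0` if `α` has a zero, and to `1` otherwise. -/
noncomputable def existsTwo (α : ℕ → ℕ) : ℕ := if ∃ n, α n = 0 then 0 else 1

/-! ### Representations of reals, of functions on the reals and of closed sets -/

/-- A coding of the rationals by natural numbers: `⟨⟨p, r⟩, s⟩` codes `(p - r) / (s + 1)`. -/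
def codedRat (m : ℕ) : ℚ :=
  ((m.unpair.1.unpair.1 : ℚ) - (m.unpair.1.unpair.2 : ℚ)) / ((m.unpair.2 : ℚ) + 1)

/-- `α` represents the real `x`: it is a fast converging Cauchy sequence of (codes of) rationals
with limit `x`. -/
structure RepresentsReal (α : ℕ → ℕ) (x : ℝ) : Prop where
  fast : ∀ i j : ℕ, i ≤ j → |codedRat (α i) - codedRat (α j)| ≤ 1 / 2 ^ i
  lim : Tendsto (fun i => (codedRat (α i) : ℝ)) atTop (𝓝 x)

/-- `A` represents the sequence of reals `a`. -/
def RepresentsRealSeq (A : ℕ → ℕ) (a : ℕ → ℝ) : Prop :=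
  ∀ n, RepresentsReal (fun i => A (Nat.pair n i)) (a n)

/-- The sequence `m, α 0, α 1, …`. -/
def seqCons (m : ℕ) (α : ℕ → ℕ) : ℕ → ℕ
  | 0 => m
  | i + 1 => α i

/-- The type `2` object `F` represents the sequence of functions `f n : ℝ → ℝ`: the map
`α ↦ (i ↦ F (n, i, α 0, α 1, …))` on Baire space takes every representation of a real `x` to a
representation of `f n x`. -/
def RepresentsFunSeq (F : (ℕ → ℕ) → ℕ) (f : ℕ → ℝ → ℝ) : Prop :=
  ∀ (n : ℕ) (x : ℝ) (α : ℕ → ℕ), RepresentsReal α x →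
    RepresentsReal (fun i => F (seqCons n (seqCons i α))) (f n x)

/-- The sequences of reals `a` and `b` are an RM-code of the closed set `C`: the complement of
`C` is the union of the open intervals `(a n, b n)`. -/
def IsRMCodeClosed (a b : ℕ → ℝ) (C : Set ℝ) : Prop :=
  Cᶜ = ⋃ n, Ioo (a n) (b n)

/-! Fix `k`. The closed sets of those `z ∈ C` with `|f n z - v| ≤ 1 / 2 ^ k` for all `n ≥ N`, where
`v` is rational, cover `C` by pointwise convergence. By the Baire category theorem, every nonempty
relatively open part of `C` contains an interior point of one of them (`exists_isRefinement`).
Nested balls chosen in this way shrink to a point of `C` at which the oscillation of the limit is at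
most `2 / 2 ^ k` for every `k`.

For computability, each stage takes the least code of a suitable ball. Suitability quantifies over
points of `C`, but compactness reduces a bound for a continuous function on a bounded part of `C` to
number quantifiers over its values at rationals and the RM-code
(`IsRMCodeClosed.forall_mem_le_zero_iff`). Strict comparison of a real with a rational needs one
number quantifier over any representation. So suitability is arithmetical in the data, and `∃²`
decides it. The balls depend on `f` and `C` alone, so `x` does not depend on the representations. -/

/-! ### Rearranging argument lists -/

namespace KleeneComputes

/-- S9 runs an index on an initial segment of the arguments and drops the rest; S4 supplies `e` as a
constant. -/
theorem append_right {e v : ℕ} {l₁ : List KArg} (h : KleeneComputes e l₁ v) (l₂ : List KArg) :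
    KleeneComputes (Nat.pair 4 (Nat.pair (Nat.pair 9 l₁.length) (Nat.pair 2 e))) (l₁ ++ l₂) v :=
  S4 _ _ _ e v (S2 e _) (S9 e l₁ l₂ v h)

/-- Two adjacent blocks of arguments at the front can be exchanged. -/
theorem exists_swap (n k e : ℕ) : ∃ e', ∀ (X Y l : List KArg) (v : ℕ), X.length = k → Y.length = n →
    KleeneComputes e (Y ++ (X ++ l)) v → KleeneComputes e' (X ++ (Y ++ l)) v := by
  induction n generalizing k e with
  | zero =>
    refine ⟨e, fun X Y l v _ hY h => ?_⟩
    obtain rfl := List.length_eq_zero_iff.mp hY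
    exact h
  | succ n ih =>
    -- S6 moves the head `y` of `Y` behind `X`, where it counts as the last entry of that block.
    obtain ⟨e', he'⟩ := ih (k + 1) (Nat.pair 6 (Nat.pair e (n + k)))
    refine ⟨e', fun X Y l v hX hY h => ?_⟩
    obtain ⟨y, Y, rfl⟩ := List.exists_cons_of_length_eq_add_one hY
    have hY' : Y.length = n := by simpa using hY
    have h1 := S6 e y (Y ++ X) l v (by simpa using h)
    have h2 := he' (X ++ [y]) Y l v (by simp [hX]) hY'
      (by simpa [hX, hY'] using h1)
    simpa using h2

/-- Two adjacent blocks of arguments after a fixed prefix can be exchanged. -/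
theorem exists_swap_after (m n k e : ℕ) : ∃ e', ∀ (P X Y l : List KArg) (v : ℕ),
    P.length = m → X.length = k → Y.length = n →
    KleeneComputes e (P ++ (Y ++ (X ++ l))) v → KleeneComputes e' (P ++ (X ++ (Y ++ l))) v := by
  obtain ⟨e₁, h₁⟩ := exists_swap m n e
  obtain ⟨e₂, h₂⟩ := exists_swap n (m + k) e₁
  refine ⟨e₂, fun P X Y l v hP hX hY h => ?_⟩
  have a := h₁ Y P (X ++ l) v hY hP h
  simpa using h₂ (P ++ X) Y l v (by simp [hP, hX]) hY (by simpa using a)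

end KleeneComputes

/-! ### Primitive recursive functions -/

/-- `p` is computed by an index which ignores all further arguments. -/
def KleeneNumeric {n : ℕ} (p : List.Vector ℕ n → ℕ) : Prop :=
  ∃ e, ∀ v l, KleeneComputes e (v.toList.map KArg.num ++ l) (p v)

namespace KleeneNumeric

/-- S4 adds one number at a time, so the values are pushed from the last to the first. A swap lets
each evaluation reach `v` beneath the values already pushed. -/
theorem exists_push {n m : ℕ} (g : Fin n → List.Vector ℕ m → ℕ) (hg : ∀ i, KleeneNumeric (g i))
    (e : ℕ) : ∃ e', ∀ (v : List.Vector ℕ m) (l : List KArg) (w : ℕ),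
      KleeneComputes e ((List.Vector.ofFn fun i => g i v).toList.map KArg.num ++
        (v.toList.map KArg.num ++ l)) w →
      KleeneComputes e' (v.toList.map KArg.num ++ l) w := by
  induction n generalizing e with
  | zero => exact ⟨e, fun v l w h => by simpa using h⟩
  | succ n ih =>
    obtain ⟨c, hc⟩ := hg 0
    obtain ⟨c', hc'⟩ := KleeneComputes.exists_swap m n c
    obtain ⟨e', he'⟩ := ih (fun i => g i.succ) (fun i => hg _) (Nat.pair 4 (Nat.pair e c'))
    refine ⟨e', fun v l w h => he' v l w ?_⟩
    refine KleeneComputes.S4 _ _ _ (g 0 v) w (hc' _ _ _ _ (by simp) (by simp) (hc v _)) ?_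
    simpa [List.Vector.ofFn] using h

theorem of_primrec' {n : ℕ} {p : List.Vector ℕ n → ℕ} (hp : Nat.Primrec' p) :
    KleeneNumeric p := by
  induction hp with
  | zero => exact ⟨_, fun v l => KleeneComputes.S2 0 _⟩
  | succ =>
    refine ⟨Nat.pair 1 0, fun v l => ?_⟩
    rw [← List.Vector.cons_head_tail v]
    exact KleeneComputes.S1 _ _
  | @get n i =>
    refine ⟨Nat.pair 6 (Nat.pair (Nat.pair 3 0) i), fun v l => ?_⟩
    have hi : (i : ℕ) < v.toList.length := by simp
    have hv : v.toList = v.toList.take i ++ v.get i :: v.toList.drop (i + 1) := by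
      rw [List.Vector.get_eq_get_toList]
      simp
    have := KleeneComputes.S6 (Nat.pair 3 0) (KArg.num (v.get i))
      ((v.toList.take i).map KArg.num) ((v.toList.drop (i + 1)).map KArg.num ++ l) (v.get i)
      (KleeneComputes.S3 _ _)
    have hlen : ((v.toList.take i).map KArg.num).length = i := by simp
    rw [hlen] at this
    rw [hv]
    simpa using this
  | @comp m n f g hf hg ihf ihg =>
    obtain ⟨e, he⟩ := ihf
    obtain ⟨e', he'⟩ := exists_push g ihg e
    exact ⟨e', fun v l => he' v l _ (he _ _)⟩
  | @prec n f g hf hg ihf ihg =>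
    obtain ⟨d, hd⟩ := ihf
    obtain ⟨c, hc⟩ := ihg
    refine ⟨Nat.pair 5 (Nat.pair d c), fun v l => ?_⟩
    rw [← List.Vector.cons_head_tail v]
    simp only [List.Vector.head_cons, List.Vector.tail_cons, List.Vector.toList_cons, List.map_cons,
      List.cons_append]
    induction v.head with
    | zero => exact KleeneComputes.S5_zero _ _ _ _ (hd _ _)
    | succ x ih =>
      refine KleeneComputes.S5_succ _ _ _ _ _ _ ih ?_
      simpa using hc (x ::ᵥ _ ::ᵥ v.tail) l

theorem of_primrec {n : ℕ} {p : List.Vector ℕ n → ℕ} (hp : Primrec p) : KleeneNumeric p :=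
  of_primrec' (Nat.Primrec'.of_prim hp)

end KleeneNumeric

/-! ### Computability uniform in the data -/

/-- A pointwise convergent sequence of continuous functions and a nonempty coded closed set,
together with representations of them. -/
structure BaireOneData where
  f : ℕ → ℝ → ℝ
  g : ℝ → ℝ
  C : Set ℝ
  a : ℕ → ℝ
  b : ℕ → ℝ
  F : (ℕ → ℕ) → ℕ
  A : ℕ → ℕ
  B : ℕ → ℕ
  continuous_f : ∀ n, Continuous (f n)
  tendsto_f : ∀ x, Tendsto (fun n => f n x) atTop (𝓝 (g x))
  nonempty : C.Nonempty
  code : IsRMCodeClosed a b C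
  repr_f : RepresentsFunSeq F f
  repr_a : RepresentsRealSeq A a
  repr_b : RepresentsRealSeq B b

namespace BaireOneData

/-- The arguments of higher type of the computations. -/
noncomputable def args (d : BaireOneData) : List KArg :=
  [KArg.fn2 existsTwo, KArg.fn2 d.F, KArg.fn d.A, KArg.fn d.B]

@[simp] theorem length_args (d : BaireOneData) : d.args.length = 4 := rfl

end BaireOneData

/-- One index computes `h d` from the arguments of higher type of `d`, for all `d`. -/
def NatComputable (h : BaireOneData → ℕ → ℕ) : Prop :=
  ∃ e, ∀ d x, KleeneComputes e (KArg.num x :: d.args) (h d x)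

namespace NatComputable

variable {g h : BaireOneData → ℕ → ℕ}

/-- Inside a larger computation the list carries extra numbers, but an index for `h` expects one
number followed by `d.args`. So `p v` is put in front, a swap brings `d.args` next to it, and S9
discards the rest. -/
theorem exists_index (hh : NatComputable h) {n : ℕ} {p : List.Vector ℕ n → ℕ}
    (hp : KleeneNumeric p) (k : ℕ) : ∃ e, ∀ (d : BaireOneData) (v : List.Vector ℕ n)
      (ys l : List KArg), ys.length = k →
      KleeneComputes e (v.toList.map KArg.num ++ (ys ++ (d.args ++ l))) (h d (p v)) := by
  obtain ⟨e, he⟩ := hh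
  obtain ⟨c, hc⟩ := hp
  obtain ⟨e', he'⟩ := KleeneComputes.exists_swap_after 1 4 (n + k)
    (Nat.pair 4 (Nat.pair (Nat.pair 9 5) (Nat.pair 2 e)))
  refine ⟨Nat.pair 4 (Nat.pair e' c), fun d v ys l hys => ?_⟩
  refine KleeneComputes.S4 _ _ _ (p v) _ (hc _ _) ?_
  have := he' [KArg.num (p v)] (v.toList.map KArg.num ++ ys) d.args l (h d (p v)) rfl
    (by simp [hys]) rfl (by simpa using (he d (p v)).append_right _)
  simpa using this

theorem congr (hg : NatComputable g) (H : ∀ d x, h d x = g d x) : NatComputable h := by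
  have : h = g := funext₂ H
  exact this ▸ hg

theorem of_primrec {p : ℕ → ℕ} (hp : Primrec p) : NatComputable fun _ => p := by
  obtain ⟨e, he⟩ := KleeneNumeric.of_primrec (n := 1) (p := fun v => p v.head)
    (hp.comp Primrec.vector_head)
  exact ⟨e, fun d x => he (x ::ᵥ List.Vector.nil) d.args⟩

theorem comp (hg : NatComputable g) (hh : NatComputable h) :
    NatComputable fun d x => g d (h d x) := by
  obtain ⟨c, hc⟩ := hh
  obtain ⟨e, he⟩ := hg.exists_index (n := 2) (p := fun v => v.head)
    (KleeneNumeric.of_primrec Primrec.vector_head) 0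
  refine ⟨Nat.pair 4 (Nat.pair e c), fun d x => KleeneComputes.S4 _ _ _ _ _ (hc d x) ?_⟩
  simpa using he d (h d x ::ᵥ x ::ᵥ List.Vector.nil) [] [] rfl

theorem pair (hg : NatComputable g) (hh : NatComputable h) :
    NatComputable fun d x => Nat.pair (g d x) (h d x) := by
  obtain ⟨c, hc⟩ := hg
  obtain ⟨e, he⟩ := hh.exists_index (n := 2) (p := fun v => v.tail.head)
    (KleeneNumeric.of_primrec (Primrec.vector_head.comp Primrec.vector_tail)) 0
  obtain ⟨q, hq⟩ := KleeneNumeric.of_primrec (n := 2)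
    (p := fun v => Nat.pair v.tail.head v.head)
    (Primrec₂.natPair.comp (Primrec.vector_head.comp Primrec.vector_tail) Primrec.vector_head)
  refine ⟨Nat.pair 4 (Nat.pair (Nat.pair 4 (Nat.pair q e)) c), fun d x =>
    KleeneComputes.S4 _ _ _ _ _ (hc d x) (KleeneComputes.S4 _ _ _ (h d x) _ ?_ ?_)⟩
  · simpa using he d (g d x ::ᵥ x ::ᵥ List.Vector.nil) [] [] rfl
  · simpa using hq (h d x ::ᵥ g d x ::ᵥ List.Vector.nil) (KArg.num x :: d.args)

theorem natRec (hg : NatComputable g) (hh : NatComputable h) :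
    NatComputable fun d x => Nat.rec (g d x.unpair.1)
      (fun y u => h d (Nat.pair x.unpair.1 (Nat.pair y u))) x.unpair.2 := by
  obtain ⟨c, hc⟩ := hg.exists_index (n := 2) (p := fun v => v.head)
    (KleeneNumeric.of_primrec Primrec.vector_head) 0
  obtain ⟨e, he⟩ := hh.exists_index (n := 4)
    (p := fun v => Nat.pair v.tail.tail.head (Nat.pair v.head v.tail.head))
    (KleeneNumeric.of_primrec (Primrec₂.natPair.comp
      (Primrec.vector_head.comp (Primrec.vector_tail.comp Primrec.vector_tail))
      (Primrec₂.natPair.comp Primrec.vector_head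
        (Primrec.vector_head.comp Primrec.vector_tail)))) 0
  obtain ⟨q, hq⟩ := KleeneNumeric.exists_push (n := 2) (m := 1)
    (fun i v => if i = 0 then v.head.unpair.2 else v.head.unpair.1)
    (fun i => by
      have : Primrec fun v : List.Vector ℕ 1 => v.head.unpair :=
        Primrec.unpair.comp Primrec.vector_head
      fin_cases i
      · exact KleeneNumeric.of_primrec (Primrec.snd.comp this)
      · exact KleeneNumeric.of_primrec (Primrec.fst.comp this))
    (Nat.pair 5 (Nat.pair c e))
  refine ⟨q, fun d x => ?_⟩
  refine hq (x ::ᵥ List.Vector.nil) d.args _ ?_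
  suffices ∀ a n : ℕ, KleeneComputes (Nat.pair 5 (Nat.pair c e))
      (KArg.num n :: KArg.num a :: KArg.num x :: d.args)
      (Nat.rec (g d a) (fun y u => h d (Nat.pair a (Nat.pair y u))) n) by
    simpa [List.Vector.ofFn] using this x.unpair.1 x.unpair.2
  intro a n
  induction n with
  | zero =>
    refine KleeneComputes.S5_zero _ _ _ _ ?_
    simpa using hc d (a ::ᵥ x ::ᵥ List.Vector.nil) [] [] rfl
  | succ n ih =>
    refine KleeneComputes.S5_succ _ _ _ _ _ _ ih ?_
    simpa using he d (n ::ᵥ _ ::ᵥ a ::ᵥ x ::ᵥ List.Vector.nil) [] [] rfl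

theorem apply_A : NatComputable fun d => d.A :=
  ⟨Nat.pair 6 (Nat.pair (Nat.pair 7 0) 3), fun d x =>
    KleeneComputes.S6 (Nat.pair 7 0) (KArg.fn d.A)
      [KArg.num x, KArg.fn2 existsTwo, KArg.fn2 d.F] [KArg.fn d.B] _ (KleeneComputes.S7 _ _ _)⟩

theorem apply_B : NatComputable fun d => d.B :=
  ⟨Nat.pair 6 (Nat.pair (Nat.pair 7 0) 4), fun d x =>
    KleeneComputes.S6 (Nat.pair 7 0) (KArg.fn d.B)
      [KArg.num x, KArg.fn2 existsTwo, KArg.fn2 d.F, KArg.fn d.A] [] _ (KleeneComputes.S7 _ _ _)⟩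

/-- S8 needs the functional in front, and S6 moves it there; inside the oracle call another S6
restores the standard order. The premise of S8 holds because `h d` is total. -/
theorem apply_existsTwo (hh : NatComputable h) :
    NatComputable fun d x => existsTwo fun y => h d (Nat.pair x y) := by
  obtain ⟨e, he⟩ := hh.exists_index (n := 2) (p := fun v => Nat.pair v.head v.tail.head)
    (KleeneNumeric.of_primrec (Primrec₂.natPair.comp Primrec.vector_head
      (Primrec.vector_head.comp Primrec.vector_tail))) 0
  refine ⟨Nat.pair 6 (Nat.pair (Nat.pair 8 (Nat.pair 6 (Nat.pair e 2)))
    1), fun d x => ?_⟩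
  refine KleeneComputes.S6 _ (KArg.fn2 existsTwo) [KArg.num x]
    [KArg.fn2 d.F, KArg.fn d.A, KArg.fn d.B] _ ?_
  refine KleeneComputes.S8 (j := 0) _ existsTwo _ _ fun y : ℕ => ?_
  refine KleeneComputes.S6 _ (KArg.num x) [KArg.num y, KArg.fn2 existsTwo]
    [KArg.fn2 d.F, KArg.fn d.A, KArg.fn d.B] _ ?_
  exact he d (x ::ᵥ y ::ᵥ List.Vector.nil) [] [] rfl

theorem apply_F (hh : NatComputable h) :
    NatComputable fun d x => d.F fun y => h d (Nat.pair x y) := by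
  obtain ⟨e, he⟩ := hh.exists_index (n := 2) (p := fun v => Nat.pair v.tail.head v.head)
    (KleeneNumeric.of_primrec (Primrec₂.natPair.comp
      (Primrec.vector_head.comp Primrec.vector_tail) Primrec.vector_head)) 0
  refine ⟨Nat.pair 6 (Nat.pair (Nat.pair 8 (Nat.pair 6 (Nat.pair (Nat.pair 6 (Nat.pair
    (Nat.pair 6 (Nat.pair (Nat.pair 6 (Nat.pair e 3)) 3)) 3)) 1))) 2), fun d x => ?_⟩
  refine KleeneComputes.S6 _ (KArg.fn2 d.F) [KArg.num x, KArg.fn2 existsTwo]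
    [KArg.fn d.A, KArg.fn d.B] _ ?_
  refine KleeneComputes.S8 (j := 0) _ d.F _ _ fun y : ℕ => ?_
  refine KleeneComputes.S6 _ (KArg.fn2 d.F) [KArg.num y]
    [KArg.num x, KArg.fn2 existsTwo, KArg.fn d.A, KArg.fn d.B] _ ?_
  refine KleeneComputes.S6 _ (KArg.fn2 existsTwo) [KArg.fn2 d.F, KArg.num y, KArg.num x]
    [KArg.fn d.A, KArg.fn d.B] _ ?_
  refine KleeneComputes.S6 _ (KArg.num x) [KArg.fn2 existsTwo, KArg.fn2 d.F, KArg.num y]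
    [KArg.fn d.A, KArg.fn d.B] _ ?_
  refine KleeneComputes.S6 _ (KArg.num y) [KArg.num x, KArg.fn2 existsTwo, KArg.fn2 d.F]
    [KArg.fn d.A, KArg.fn d.B] _ ?_
  exact he d (y ::ᵥ x ::ᵥ List.Vector.nil) [] [] rfl

/-- Unbounded search. -/
theorem search (hh : NatComputable h) (hex : ∀ d x, ∃ n, h d (Nat.pair x n) = 0) :
    NatComputable fun d x => Nat.find (hex d x) := by
  -- The index `c` evaluates `h`, the index `z` performs the search from the second argument on,
  -- provided that its first argument is `z` itself.
  obtain ⟨c, hc⟩ := hh.exists_index (n := 3) (p := fun v => Nat.pair v.tail.tail.head v.tail.head)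
    (KleeneNumeric.of_primrec (Primrec₂.natPair.comp
      (Primrec.vector_head.comp (Primrec.vector_tail.comp Primrec.vector_tail))
      (Primrec.vector_head.comp Primrec.vector_tail))) 0
  -- S9 will run `z` on seven arguments: `z`, `n + 1`, `x` and the four of higher type.
  obtain ⟨r, hr⟩ := KleeneComputes.exists_swap_after 4 4 5 (Nat.pair 9 7)
  obtain ⟨q, hq⟩ := KleeneNumeric.exists_push (n := 4) (m := 5)
    ![fun v => v.get 2, fun v => v.get 2, fun v => v.get 3 + 1, fun v => v.get 4]
    (fun i => by
      fin_cases i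
      · exact .of_primrec (Primrec.vector_get.comp .id (.const _))
      · exact .of_primrec (Primrec.vector_get.comp .id (.const _))
      · exact .of_primrec (Primrec.succ.comp (Primrec.vector_get.comp .id (.const _)))
      · exact .of_primrec (Primrec.vector_get.comp .id (.const _))) r
  -- S5 acts as a case distinction on the value of `h`: zero returns `n`, and every successor stage
  -- runs `z` from `n + 1`.
  set z : ℕ := Nat.pair 4 (Nat.pair (Nat.pair 5 (Nat.pair (Nat.pair 6 (Nat.pair (Nat.pair 3 0) 1))
    q)) c) with hz
  have eval : ∀ d x n, KleeneComputes c (KArg.num z :: KArg.num n :: KArg.num x :: d.args)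
      (h d (Nat.pair x n)) := fun d x n => by
    simpa using hc d (z ::ᵥ n ::ᵥ x ::ᵥ List.Vector.nil) [] [] rfl
  have key : ∀ d x n, n ≤ Nat.find (hex d x) →
      KleeneComputes z (KArg.num z :: KArg.num n :: KArg.num x :: d.args)
        (Nat.find (hex d x)) := by
    intro d x n hn
    have get : ∀ n, KleeneComputes (Nat.pair 6 (Nat.pair (Nat.pair 3 0) 1))
        (KArg.num z :: KArg.num n :: KArg.num x :: d.args) n := fun n =>
      KleeneComputes.S6 _ (KArg.num n) [KArg.num z] (KArg.num x :: d.args) _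
        (KleeneComputes.S3 _ _)
    -- The run at `n` calls the run at `n + 1`, so the induction descends from the least zero.
    induction hn using Nat.decreasingInduction with
    | self =>
      refine KleeneComputes.S4 _ _ _ _ _ (eval d x _) ?_
      rw [Nat.find_spec (hex d x)]
      exact KleeneComputes.S5_zero _ _ _ _ (get _)
    | of_succ n hn ih =>
      refine KleeneComputes.S4 _ _ _ _ _ (eval d x _) ?_
      have step : ∀ t u, KleeneComputes q (KArg.num t :: KArg.num u :: KArg.num z :: KArg.num n ::
          KArg.num x :: d.args) (Nat.find (hex d x)) := by
        intro t u
        refine hq (t ::ᵥ u ::ᵥ z ::ᵥ n ::ᵥ x ::ᵥ List.Vector.nil) d.args _ ?_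
        have := hr [KArg.num z, KArg.num z, KArg.num (n + 1), KArg.num x]
          [KArg.num t, KArg.num u, KArg.num z, KArg.num n, KArg.num x] d.args []
          (Nat.find (hex d x)) rfl rfl rfl
          (KleeneComputes.S9 z (KArg.num z :: KArg.num (n + 1) :: KArg.num x :: d.args) _ _ ih)
        simp only [List.append_nil] at this
        exact this
      have loop : ∀ t, ∃ u, KleeneComputes (Nat.pair 5 (Nat.pair
          (Nat.pair 6 (Nat.pair (Nat.pair 3 0) 1)) q))
          (KArg.num t :: KArg.num z :: KArg.num n :: KArg.num x :: d.args) u ∧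
          (t ≠ 0 → u = Nat.find (hex d x)) := by
        intro t
        induction t with
        | zero => exact ⟨n, KleeneComputes.S5_zero _ _ _ _ (get _), fun h => (h rfl).elim⟩
        | succ t iht =>
          obtain ⟨u, hu, -⟩ := iht
          exact ⟨_, KleeneComputes.S5_succ _ _ _ _ _ _ hu (step t u), fun _ => rfl⟩
      obtain ⟨u, hu, hu'⟩ := loop (h d (Nat.pair x n))
      rwa [hu' (Nat.find_min (hex d x) hn)] at hu
  refine ⟨Nat.pair 4 (Nat.pair (Nat.pair 4 (Nat.pair z (Nat.pair 2 z))) (Nat.pair 2 0)),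
    fun d x => ?_⟩
  exact KleeneComputes.S4 _ _ _ 0 _ (KleeneComputes.S2 _ _)
    (KleeneComputes.S4 _ _ _ z _ (KleeneComputes.S2 _ _) (key d x 0 (Nat.zero_le _)))

theorem sInf (hh : NatComputable h) :
    NatComputable fun d x => sInf {n | h d (Nat.pair x n) = 0} := by
  have hE : NatComputable fun d y => h d y * (1 - existsTwo fun m => h d (Nat.pair y.unpair.1 m)) :=
    ((of_primrec (p := fun y => y.unpair.1 * (1 - y.unpair.2))
      (Primrec.nat_mul.comp (Primrec.fst.comp Primrec.unpair)
        (Primrec.nat_sub.comp (.const 1) (Primrec.snd.comp Primrec.unpair)))).comp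
      (hh.pair (hh.apply_existsTwo.comp (of_primrec (Primrec.fst.comp Primrec.unpair))))).congr
      fun d x => by simp
  have hex : ∀ d x, ∃ n, h d (Nat.pair x n) *
      (1 - existsTwo fun m => h d (Nat.pair (Nat.pair x n).unpair.1 m)) = 0 := by
    intro d x
    by_cases H : ∃ n, h d (Nat.pair x n) = 0
    · exact H.imp fun n hn => by simp [hn]
    · exact ⟨0, by simp [existsTwo, H]⟩
  refine (hE.search hex).congr fun d x => ?_
  by_cases H : ∃ n, h d (Nat.pair x n) = 0
  · refine IsLeast.csInf_eq ⟨?_, fun m hm => Nat.find_min' _ ?_⟩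
    · simpa [existsTwo, H] using Nat.find_spec (hex d x)
    · simp [mem_ofPred.1 hm]
  · have : {n | h d (Nat.pair x n) = 0} = ∅ := Set.eq_empty_iff_forall_notMem.2 fun n hn => H ⟨n, hn⟩
    rw [this, Nat.sInf_empty, eq_comm, Nat.find_eq_zero]
    simp [existsTwo, H]

end NatComputable

section

variable {α β σ : Type*} [Primcodable α] [Primcodable β] [Primcodable σ]

/-- One index computes `h d` on codes from the arguments of higher type of `d`, for all `d`. -/
def DataComputable (h : BaireOneData → α → σ) : Prop :=
  ∃ u, NatComputable u ∧ ∀ d x, u d (Encodable.encode x) = Encodable.encode (h d x)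

namespace DataComputable

theorem of_primrec {h : α → σ} (hh : Primrec h) : DataComputable fun _ => h :=
  ⟨_, NatComputable.of_primrec (Primrec.pred.comp (Primrec.nat_iff.2 hh)), fun d x => by
    simp [Encodable.encodek]⟩

theorem comp {g : BaireOneData → β → σ} {h : BaireOneData → α → β} (hg : DataComputable g)
    (hh : DataComputable h) : DataComputable fun d x => g d (h d x) := by
  obtain ⟨u, hu, hu'⟩ := hg
  obtain ⟨v, hv, hv'⟩ := hh
  exact ⟨_, hu.comp hv, fun d x => by simp [hu', hv']⟩

theorem comp_primrec {g : BaireOneData → β → σ} {h : α → β} (hg : DataComputable g)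
    (hh : Primrec h) : DataComputable fun d x => g d (h x) :=
  hg.comp (of_primrec hh)

theorem pair {g : BaireOneData → α → β} {h : BaireOneData → α → σ} (hg : DataComputable g)
    (hh : DataComputable h) : DataComputable fun d x => (g d x, h d x) := by
  obtain ⟨u, hu, hu'⟩ := hg
  obtain ⟨v, hv, hv'⟩ := hh
  exact ⟨_, hu.pair hv, fun d x => by simp [hu', hv']⟩

theorem map {p : β → σ} (hp : Primrec p) {h : BaireOneData → α → β} (hh : DataComputable h) :
    DataComputable fun d x => p (h d x) :=
  (of_primrec hp).comp hh

theorem map₂ {γ : Type*} [Primcodable γ] {p : β → γ → σ} (hp : Primrec₂ p)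
    {g : BaireOneData → α → β} {h : BaireOneData → α → γ} (hg : DataComputable g)
    (hh : DataComputable h) : DataComputable fun d x => p (g d x) (h d x) :=
  (of_primrec hp).comp (hg.pair hh)

theorem natRec {g : BaireOneData → α → σ} {h : BaireOneData → α × ℕ × σ → σ}
    (hg : DataComputable g) (hh : DataComputable h) : DataComputable fun d (x : α × ℕ) =>
      (Nat.rec (g d x.1) (fun y u => h d (x.1, y, u)) x.2 : σ) := by
  obtain ⟨u, hu, hu'⟩ := hg
  obtain ⟨v, hv, hv'⟩ := hh
  refine ⟨_, hu.natRec hv, ?_⟩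
  rintro d ⟨x, n⟩
  simp only [Encodable.encode_prod_val, Nat.unpair_pair, Encodable.encode_nat]
  induction n with
  | zero => exact hu' d x
  | succ n ih => simp only [ih, ← hv' d, Encodable.encode_prod_val, Encodable.encode_nat]

theorem apply_A : DataComputable fun d => d.A := ⟨_, .apply_A, fun _ _ => rfl⟩

theorem apply_B : DataComputable fun d => d.B := ⟨_, .apply_B, fun _ _ => rfl⟩

theorem apply_F {h : BaireOneData → α × ℕ → ℕ} (hh : DataComputable h) :
    DataComputable fun d x => d.F fun y => h d (x, y) := by
  obtain ⟨u, hu, hu'⟩ := hh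
  refine ⟨_, hu.apply_F, fun d x => ?_⟩
  have := fun y => hu' d (x, y)
  simp only [Encodable.encode_prod_val, Encodable.encode_nat] at this
  simp [this]

end DataComputable

/-- One index decides the predicate `p d` on codes from the arguments of higher type of `d`, for
all `d`. -/
def DataDecidable (p : BaireOneData → α → Prop) : Prop :=
  ∃ u : BaireOneData → α → ℕ, DataComputable u ∧ ∀ d x, p d x ↔ u d x = 0

namespace DataDecidable

variable {p q : BaireOneData → α → Prop}

theorem of_iff (hq : DataDecidable q) (h : ∀ d x, p d x ↔ q d x) : DataDecidable p := by
  obtain ⟨u, hu, hu'⟩ := hq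
  exact ⟨u, hu, fun d x => (h d x).trans (hu' d x)⟩

theorem of_primrecPred {p : α → Prop} (hp : PrimrecPred p) : DataDecidable fun _ => p := by
  classical
  exact ⟨fun _ x => if p x then 0 else 1,
    .of_primrec (Primrec.ite hp (.const 0) (.const 1)), fun d x => by simp⟩

theorem comp {h : BaireOneData → β → α} (hp : DataDecidable p) (hh : DataComputable h) :
    DataDecidable fun d x => p d (h d x) := by
  obtain ⟨u, hu, hu'⟩ := hp
  exact ⟨_, hu.comp hh, fun d x => hu' d _⟩

theorem comp_primrec {h : β → α} (hp : DataDecidable p) (hh : Primrec h) :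
    DataDecidable fun d x => p d (h x) :=
  hp.comp (.of_primrec hh)

theorem not (hp : DataDecidable p) : DataDecidable fun d x => ¬ p d x := by
  obtain ⟨u, hu, hu'⟩ := hp
  exact ⟨_, hu.map (p := fun n => 1 - n) (Primrec.nat_sub.comp (.const 1) .id), fun d x => by
    simp only [hu' d x]; omega⟩

theorem and (hp : DataDecidable p) (hq : DataDecidable q) :
    DataDecidable fun d x => p d x ∧ q d x := by
  obtain ⟨u, hu, hu'⟩ := hp
  obtain ⟨v, hv, hv'⟩ := hq
  exact ⟨_, .map₂ Primrec.nat_add hu hv, fun d x => by simp [hu', hv']⟩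

theorem or (hp : DataDecidable p) (hq : DataDecidable q) :
    DataDecidable fun d x => p d x ∨ q d x :=
  (hp.not.and hq.not).not.of_iff fun d x => by tauto

theorem imp (hp : DataDecidable p) (hq : DataDecidable q) :
    DataDecidable fun d x => p d x → q d x :=
  (hp.not.or hq).of_iff fun d x => by tauto

theorem exists_nat {p : BaireOneData → α × ℕ → Prop} (hp : DataDecidable p) :
    DataDecidable fun d x => ∃ n, p d (x, n) := by
  obtain ⟨u, ⟨v, hv, hv'⟩, hu'⟩ := hp
  refine ⟨fun d x => existsTwo fun n => u d (x, n), ⟨_, hv.apply_existsTwo, fun d x => ?_⟩,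
    fun d x => ?_⟩
  · have := fun n => hv' d (x, n)
    simp only [Encodable.encode_prod_val, Encodable.encode_nat] at this
    simp [this]
  · simp [existsTwo, hu']

theorem forall_nat {p : BaireOneData → α × ℕ → Prop} (hp : DataDecidable p) :
    DataDecidable fun d x => ∀ n, p d (x, n) :=
  hp.not.exists_nat.not.of_iff fun d x => by simp

theorem sInf {p : BaireOneData → α × ℕ → Prop} (hp : DataDecidable p) :
    DataComputable fun d x => sInf {n | p d (x, n)} := by
  obtain ⟨u, ⟨v, hv, hv'⟩, hu'⟩ := hp
  refine ⟨_, hv.sInf, fun d x => ?_⟩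
  have := fun n => hv' d (x, n)
  simp only [Encodable.encode_prod_val, Encodable.encode_nat] at this
  simp [this, hu']

end DataDecidable

end

section

variable {α β : Type*} [Primcodable α] [Primcodable β]

/-- A code of the rational `(p - r) / (s + 1)`. -/
def ratCode (p r s : ℕ) : ℕ := Nat.pair (Nat.pair p r) s

@[simp] theorem codedRat_ratCode (p r s : ℕ) : codedRat (ratCode p r s) = ((p : ℚ) - r) / (s + 1) := by
  simp [codedRat, ratCode]

theorem exists_codedRat_eq (q : ℚ) : ∃ m, codedRat m = q := by
  refine ⟨ratCode q.num.toNat (-q.num).toNat (q.den - 1), ?_⟩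
  have hd : ((q.den - 1 : ℕ) : ℚ) + 1 = q.den := by exact_mod_cast Nat.sub_add_cancel q.pos
  have hn : ((q.num.toNat : ℕ) : ℚ) - ((-q.num).toNat : ℕ) = q.num := by
    exact_mod_cast Int.toNat_sub_toNat_neg q.num
  rw [codedRat_ratCode, hd, hn, Rat.num_div_den]

theorem exists_codedRat_near (x : ℝ) {ε : ℝ} (hε : 0 < ε) : ∃ m, |(codedRat m : ℝ) - x| < ε := by
  obtain ⟨q, h₁, h₂⟩ := exists_rat_btwn (show x - ε < x + ε by linarith)
  obtain ⟨m, rfl⟩ := exists_codedRat_eq q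
  exact ⟨m, abs_lt.2 ⟨by linarith, by linarith⟩⟩

/-- The rationals `q d x` have computable codes. -/
def RatComputable (q : BaireOneData → α → ℚ) : Prop :=
  ∃ u : BaireOneData → α → ℕ, DataComputable u ∧ ∀ d x, q d x = codedRat (u d x)

theorem primrec_ratCode : Primrec fun x : ℕ × ℕ × ℕ => ratCode x.1 x.2.1 x.2.2 :=
  Primrec₂.natPair.comp (Primrec₂.natPair.comp .fst (Primrec.fst.comp .snd))
    (Primrec.snd.comp .snd)

namespace RatComputable

variable {q r : BaireOneData → α → ℚ}

theorem codedRat {u : BaireOneData → α → ℕ} (hu : DataComputable u) :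
    RatComputable fun d x => codedRat (u d x) := ⟨u, hu, fun _ _ => rfl⟩

theorem comp_primrec {h : β → α} (hq : RatComputable q) (hh : Primrec h) :
    RatComputable fun d x => q d (h x) := by
  obtain ⟨u, hu, hu'⟩ := hq
  exact ⟨_, hu.comp_primrec hh, fun d x => hu' d _⟩

theorem const (c : ℚ) : RatComputable fun _ (_ : α) => c := by
  obtain ⟨m, hm⟩ := exists_codedRat_eq c
  exact ⟨fun _ _ => m, .of_primrec (.const m), fun _ _ => hm.symm⟩

theorem exists_fraction (hq : RatComputable q) : ∃ p r s : BaireOneData → α → ℕ,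
    DataComputable p ∧ DataComputable r ∧ DataComputable s ∧
      ∀ d x, q d x = ((p d x : ℚ) - r d x) / (s d x + 1) := by
  obtain ⟨u, hu, hu'⟩ := hq
  have h₁ := hu.map (p := fun m => m.unpair.1) (Primrec.fst.comp .unpair)
  exact ⟨fun d x => (u d x).unpair.1.unpair.1, fun d x => (u d x).unpair.1.unpair.2,
    fun d x => (u d x).unpair.2, h₁.map (p := fun m => m.unpair.1) (Primrec.fst.comp .unpair),
    h₁.map (p := fun m => m.unpair.2) (Primrec.snd.comp .unpair),
    hu.map (p := fun m => m.unpair.2) (Primrec.snd.comp .unpair), hu'⟩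

theorem of_fraction {p r s : BaireOneData → α → ℕ} (hp : DataComputable p) (hr : DataComputable r)
    (hs : DataComputable s) :
    RatComputable fun d x => ((p d x : ℚ) - r d x) / (s d x + 1) :=
  ⟨_, (hp.pair (hr.pair hs)).map primrec_ratCode, fun d x => by simp⟩

theorem congr (hq : RatComputable q) (h : ∀ d x, r d x = q d x) : RatComputable r :=
  (funext₂ h : r = q) ▸ hq

theorem neg (hq : RatComputable q) : RatComputable fun d x => -q d x := by
  obtain ⟨p, r, s, hp, hr, hs, h⟩ := hq.exists_fraction
  exact (of_fraction hr hp hs).congr fun d x => by rw [h]; ring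

theorem add (hq : RatComputable q) (hr : RatComputable r) :
    RatComputable fun d x => q d x + r d x := by
  obtain ⟨p₁, r₁, s₁, hp₁, hr₁, hs₁, h₁⟩ := hq.exists_fraction
  obtain ⟨p₂, r₂, s₂, hp₂, hr₂, hs₂, h₂⟩ := hr.exists_fraction
  have cross {u v : BaireOneData → α → ℕ} (hu : DataComputable u) (hv : DataComputable v) :
      DataComputable fun d x => u d x * s₂ d x + u d x + (v d x * s₁ d x + v d x) :=
    .map₂ Primrec.nat_add (.map₂ Primrec.nat_add (.map₂ Primrec.nat_mul hu hs₂) hu)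
      (.map₂ Primrec.nat_add (.map₂ Primrec.nat_mul hv hs₁) hv)
  refine (of_fraction (cross hp₁ hp₂) (cross hr₁ hr₂)
    (.map₂ Primrec.nat_add (.map₂ Primrec.nat_mul hs₁ hs₂)
      (.map₂ Primrec.nat_add hs₁ hs₂))).congr fun d x => ?_
  rw [h₁, h₂]
  have e₁ : (s₁ d x : ℚ) + 1 ≠ 0 := by positivity
  have e₂ : (s₂ d x : ℚ) + 1 ≠ 0 := by positivity
  have e₃ : ((s₁ d x * s₂ d x + (s₁ d x + s₂ d x) : ℕ) : ℚ) + 1 =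
      ((s₁ d x : ℚ) + 1) * (s₂ d x + 1) := by push_cast; ring
  rw [e₃, div_add_div _ _ e₁ e₂]
  push_cast
  ring

theorem sub (hq : RatComputable q) (hr : RatComputable r) :
    RatComputable fun d x => q d x - r d x :=
  (hq.add hr.neg).congr fun _ _ => sub_eq_add_neg _ _

theorem inv_two_pow {u : BaireOneData → α → ℕ} (hu : DataComputable u) :
    RatComputable fun d x => 1 / 2 ^ u d x := by
  have hpow : Primrec fun n : ℕ => 2 ^ n - 1 :=
    Primrec.pred.comp ((Primrec₂.unpaired'.1 Nat.Primrec.pow).comp (.const 2) .id)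
  refine (of_fraction (.of_primrec (.const 1)) (.of_primrec (.const 0)) (hu.map hpow)).congr
    fun d x => ?_
  simp

theorem lt (hq : RatComputable q) (hr : RatComputable r) :
    DataDecidable fun d x => q d x < r d x := by
  obtain ⟨p, r, s, hp, hr, hs, h⟩ := (hr.sub hq).exists_fraction
  refine ((DataDecidable.of_primrecPred (Primrec.nat_lt)).comp (hr.pair hp)).of_iff fun d x => ?_
  rw [← sub_pos, h, div_pos_iff_of_pos_right (by positivity), sub_pos, Nat.cast_lt]

theorem le (hq : RatComputable q) (hr : RatComputable r) :
    DataDecidable fun d x => q d x ≤ r d x :=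
  (hr.lt hq).not.of_iff fun _ _ => not_lt.symm

end RatComputable

theorem RepresentsReal.abs_sub_le {ξ : ℕ → ℕ} {x : ℝ} (h : RepresentsReal ξ x) (i : ℕ) :
    |(codedRat (ξ i) : ℝ) - x| ≤ 1 / 2 ^ i := by
  refine le_of_tendsto ((tendsto_const_nhds.sub h.lim).abs) ?_
  filter_upwards [eventually_ge_atTop i] with j hj
  have := (Rat.cast_le (K := ℝ)).2 (h.fast i j hj)
  push_cast at this
  exact this

theorem RepresentsReal.lt_iff {ξ : ℕ → ℕ} {x : ℝ} (h : RepresentsReal ξ x) (q : ℚ) :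
    x < q ↔ ∃ i, codedRat (ξ i) + 1 / 2 ^ i < q := by
  constructor
  · intro hx
    obtain ⟨i, hi⟩ := exists_pow_lt_of_lt_one (show 0 < ((q : ℝ) - x) / 2 by linarith)
      (show (1 / 2 : ℝ) < 1 by norm_num)
    rw [one_div_pow] at hi
    refine ⟨i, ?_⟩
    have := abs_le.1 (h.abs_sub_le i)
    rw [← Rat.cast_lt (K := ℝ)]
    push_cast
    linarith
  · rintro ⟨i, hi⟩
    have := abs_le.1 (h.abs_sub_le i)
    have h' := (Rat.cast_lt (K := ℝ)).2 hi
    push_cast at h'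
    linarith

theorem RepresentsReal.gt_iff {ξ : ℕ → ℕ} {x : ℝ} (h : RepresentsReal ξ x) (q : ℚ) :
    q < x ↔ ∃ i, q < codedRat (ξ i) - 1 / 2 ^ i := by
  constructor
  · intro hx
    obtain ⟨i, hi⟩ := exists_pow_lt_of_lt_one (show 0 < (x - q) / 2 by linarith)
      (show (1 / 2 : ℝ) < 1 by norm_num)
    rw [one_div_pow] at hi
    refine ⟨i, ?_⟩
    have := abs_le.1 (h.abs_sub_le i)
    rw [← Rat.cast_lt (K := ℝ)]
    push_cast
    linarith
  · rintro ⟨i, hi⟩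
    have := abs_le.1 (h.abs_sub_le i)
    have h' := (Rat.cast_lt (K := ℝ)).2 hi
    push_cast at h'
    linarith

theorem representsReal_const (m : ℕ) : RepresentsReal (fun _ => m) (codedRat m) :=
  ⟨fun i j _ => by simp, tendsto_const_nhds⟩

/-- The reals `y d x` have computable representations. -/
def RealComputable (y : BaireOneData → α → ℝ) : Prop :=
  ∃ u : BaireOneData → α × ℕ → ℕ, DataComputable u ∧
    ∀ d x, RepresentsReal (fun i => u d (x, i)) (y d x)

namespace RealComputable

variable {y : BaireOneData → α → ℝ} {q : BaireOneData → α → ℚ}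

theorem lt_rat (hy : RealComputable y) (hq : RatComputable q) :
    DataDecidable fun d x => y d x < q d x := by
  obtain ⟨u, hu, hu'⟩ := hy
  refine DataDecidable.of_iff (DataDecidable.exists_nat
    (((RatComputable.codedRat hu).add (.inv_two_pow (.of_primrec .snd))).lt
      (hq.comp_primrec Primrec.fst))) fun d x => (hu' d x).lt_iff _

theorem rat_lt (hy : RealComputable y) (hq : RatComputable q) :
    DataDecidable fun d x => q d x < y d x := by
  obtain ⟨u, hu, hu'⟩ := hy
  refine DataDecidable.of_iff (DataDecidable.exists_nat
    ((hq.comp_primrec Primrec.fst).lt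
      ((RatComputable.codedRat hu).sub (.inv_two_pow (.of_primrec .snd)))))
    fun d x => (hu' d x).gt_iff _

theorem comp_primrec {h : β → α} (hy : RealComputable y) (hh : Primrec h) :
    RealComputable fun d x => y d (h x) := by
  obtain ⟨u, hu, hu'⟩ := hy
  exact ⟨_, hu.comp_primrec (h := fun x : β × ℕ => (h x.1, x.2)) ((hh.comp .fst).pair .snd),
    fun d x => hu' d (h x)⟩

theorem a : RealComputable fun d => d.a :=
  ⟨fun d x => d.A (Nat.pair x.1 x.2),
    DataComputable.apply_A.comp_primrec (Primrec₂.natPair.comp .fst .snd),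
    fun d n => d.repr_a n⟩

theorem b : RealComputable fun d => d.b :=
  ⟨fun d x => d.B (Nat.pair x.1 x.2),
    DataComputable.apply_B.comp_primrec (Primrec₂.natPair.comp .fst .snd),
    fun d n => d.repr_b n⟩

theorem f : RealComputable fun d (x : ℕ × ℕ) => d.f x.1 (codedRat x.2) := by
  refine ⟨fun d x => d.F (seqCons x.1.1 (seqCons x.2 fun _ => x.1.2)), ?_,
    fun d x => d.repr_f x.1 _ _ (representsReal_const x.2)⟩
  have : Primrec fun y : ((ℕ × ℕ) × ℕ) × ℕ =>
      if y.2 = 0 then y.1.1.1 else if y.2 = 1 then y.1.2 else y.1.1.2 :=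
    .ite (Primrec.eq.comp .snd (.const 0)) (Primrec.fst.comp (Primrec.fst.comp .fst))
      (.ite (Primrec.eq.comp .snd (.const 1)) (Primrec.snd.comp .fst)
        (Primrec.snd.comp (Primrec.fst.comp .fst)))
  convert DataComputable.apply_F (DataComputable.of_primrec this) using 4 with d x
  funext y
  match y with
  | 0 => rfl
  | 1 => rfl
  | n + 2 => simp [seqCons]

end RealComputable

end

section

variable {α : Type*} [Primcodable α]

/-- An upper bound on the values of a continuous function on a part of a coded closed set can be
expressed with rational points only. -/
theorem IsRMCodeClosed.forall_mem_le_zero_iff {a b : ℕ → ℝ} {C : Set ℝ} (hC : IsRMCodeClosed a b C)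
    {h : ℝ → ℝ} (hh : Continuous h) {c ρ : ℚ} (hρ : 0 < ρ) :
    (∀ z ∈ C, |z - c| ≤ ρ → h z ≤ 0) ↔ ∀ e : ℕ, ∃ k : ℕ, ∀ t,
      codedRat t - c ≤ ρ ∧ c - codedRat t ≤ ρ → ((1 / 2 ^ e : ℚ) : ℝ) < h (codedRat t) →
        ∃ l, a l < (codedRat t - 1 / 2 ^ k : ℚ) ∧ ((codedRat t + 1 / 2 ^ k : ℚ) : ℝ) < b l := by
  have hmem : ∀ z, z ∉ C ↔ ∃ l, a l < z ∧ z < b l := fun z => by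
    rw [← mem_compl_iff, hC]; simp
  constructor
  · intro H e
    set K : Set ℝ := Metric.closedBall (c : ℝ) ρ ∩ {z | 1 / 2 ^ e ≤ h z}
    have hK : IsCompact K :=
      (isCompact_closedBall _ _).inter_right (isClosed_le continuous_const hh)
    have hcov : K ⊆ ⋃ l, Ioo (a l) (b l) := by
      rintro z ⟨hz, hz'⟩
      have hz'' : z ∉ C := fun hzC => by
        have h₁ := H z hzC (by simpa [Real.dist_eq] using hz)
        have h₂ : (0 : ℝ) < 1 / 2 ^ e := by positivity
        have h₃ : 1 / 2 ^ e ≤ h z := hz'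
        linarith
      simpa using (hmem z).1 hz''
    obtain ⟨δ, hδ, hball⟩ := lebesgue_number_lemma_of_metric hK (fun l => isOpen_Ioo) hcov
    obtain ⟨k, hk⟩ := exists_pow_lt_of_lt_one hδ (show (1 / 2 : ℝ) < 1 by norm_num)
    rw [one_div_pow] at hk
    have hk0 : (0 : ℝ) < 1 / 2 ^ k := by positivity
    refine ⟨k, fun t ⟨h₁, h₂⟩ h₃ => ?_⟩
    have h₁' := (Rat.cast_le (K := ℝ)).2 h₁
    have h₂' := (Rat.cast_le (K := ℝ)).2 h₂
    push_cast at h₁' h₂' h₃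
    obtain ⟨l, hl⟩ := hball (codedRat t) ⟨by
      rw [Metric.mem_closedBall, Real.dist_eq, abs_le]; constructor <;> linarith, h₃.le⟩
    have hm : ((codedRat t : ℝ) - 1 / 2 ^ k) ∈ Ioo (a l) (b l) := hl (by
      rw [Metric.mem_ball, Real.dist_eq, abs_lt]; constructor <;> linarith)
    have hp : ((codedRat t : ℝ) + 1 / 2 ^ k) ∈ Ioo (a l) (b l) := hl (by
      rw [Metric.mem_ball, Real.dist_eq, abs_lt]; constructor <;> linarith)
    refine ⟨l, ?_, ?_⟩ <;> push_cast
    exacts [hm.1, hp.2]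
  · intro H z hzC hz
    by_contra! hpos
    obtain ⟨e, he⟩ := exists_pow_lt_of_lt_one hpos (show (1 / 2 : ℝ) < 1 by norm_num)
    rw [one_div_pow] at he
    obtain ⟨k, hk⟩ := H e
    have hk0 : (0 : ℝ) < 1 / 2 ^ k := by positivity
    have hρ' : (0 : ℝ) < ρ := by exact_mod_cast hρ
    have hcl : z ∈ closure (Metric.ball (c : ℝ) ρ) := by
      rw [closure_ball _ hρ'.ne']; simpa [Real.dist_eq] using hz
    have hopen : IsOpen (Metric.ball z (1 / 2 ^ k) ∩ {y | 1 / 2 ^ e < h y}) :=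
      Metric.isOpen_ball.inter (isOpen_lt continuous_const hh)
    obtain ⟨y, ⟨hy₁, hy₂⟩, hy₃⟩ := mem_closure_iff.1 hcl _ hopen
      ⟨Metric.mem_ball_self hk0, he⟩
    obtain ⟨q, ⟨hq₁, hq₂⟩, hq₃⟩ := Rat.denseRange_cast.exists_mem_open
      (hopen.inter Metric.isOpen_ball) ⟨y, ⟨hy₁, hy₂⟩, hy₃⟩
    obtain ⟨t, rfl⟩ := exists_codedRat_eq q
    rw [Metric.mem_ball, Real.dist_eq, abs_lt] at hq₁ hq₃
    obtain ⟨l, hl₁, hl₂⟩ := hk t ⟨by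
      rw [← Rat.cast_le (K := ℝ)]; push_cast; linarith, by
      rw [← Rat.cast_le (K := ℝ)]; push_cast; linarith⟩ (by push_cast; exact hq₂)
    push_cast at hl₁ hl₂
    exact (hmem z).2 ⟨l, by linarith, by linarith⟩ hzC

namespace DataDecidable

theorem forall_mem_le_zero {h : BaireOneData → α → ℝ → ℝ} (hh : ∀ d x, Continuous (h d x))
    (hlt : DataDecidable fun d (y : (α × ℕ) × ℕ) =>
      ((1 / 2 ^ y.1.2 : ℚ) : ℝ) < h d y.1.1 (codedRat y.2))
    {c ρ : BaireOneData → α → ℚ} (hc : RatComputable c) (hρ : RatComputable ρ)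
    (hpos : ∀ d x, 0 < ρ d x) :
    DataDecidable fun d x => ∀ z ∈ d.C, |z - c d x| ≤ ρ d x → h d x z ≤ 0 := by
  have ht : RatComputable fun _ (y : ((α × ℕ) × ℕ) × ℕ) => codedRat y.2 :=
    .codedRat (.of_primrec .snd)
  have hx : Primrec fun y : ((α × ℕ) × ℕ) × ℕ => y.1.1.1 :=
    Primrec.fst.comp (Primrec.fst.comp .fst)
  have hx' := Primrec.fst (α := ((α × ℕ) × ℕ) × ℕ) (β := ℕ)
  have hk : RatComputable fun _ (y : (((α × ℕ) × ℕ) × ℕ) × ℕ) => 1 / 2 ^ y.1.1.2 :=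
    .inv_two_pow (.of_primrec (Primrec.snd.comp (Primrec.fst.comp .fst)))
  have hcx := hc.comp_primrec hx
  have hρx := hρ.comp_primrec hx
  have hin := ((ht.sub hcx).le hρx).and ((hcx.sub ht).le hρx)
  have hval : DataDecidable fun d (y : ((α × ℕ) × ℕ) × ℕ) =>
      ((1 / 2 ^ y.1.1.2 : ℚ) : ℝ) < h d y.1.1.1 (codedRat y.2) :=
    hlt.comp_primrec (h := fun y : ((α × ℕ) × ℕ) × ℕ => (y.1.1, y.2))
      ((Primrec.fst.comp .fst).pair .snd)
  have hout := (((RealComputable.a.comp_primrec Primrec.snd).lt_rat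
    ((ht.comp_primrec hx').sub hk)).and ((RealComputable.b.comp_primrec Primrec.snd).rat_lt
    ((ht.comp_primrec hx').add hk))).exists_nat
  exact (hin.imp (hval.imp hout)).forall_nat.exists_nat.forall_nat.of_iff fun d x =>
    d.code.forall_mem_le_zero_iff (hh d x) (hpos d x)

end DataDecidable

end

/-- The centre of the ball coded by `s`. -/
def codedCenter (s : ℕ) : ℚ := codedRat s.unpair.1

/-- The radius of the ball coded by `s`. -/
def codedRadius (s : ℕ) : ℚ := 1 / 2 ^ s.unpair.2

theorem codedRadius_pos (s : ℕ) : 0 < codedRadius s := by unfold codedRadius; positivity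

/-- The ball coded by `s` meets `C`, and on the part of `C` in the ball with twice the radius the
functions `f n` with large `n` have values within `1 / 2 ^ k` of a rational. The second ball lies
inside the corresponding one for `s₀` if `k ≠ 0`. -/
def IsRefinement (f : ℕ → ℝ → ℝ) (C : Set ℝ) (k s₀ s : ℕ) : Prop :=
  (k = 0 ∨ |codedCenter s - codedCenter s₀| + 2 * codedRadius s < 2 * codedRadius s₀) ∧
  k + 1 ≤ s.unpair.2 ∧
  (∃ z ∈ C, |z - codedCenter s| ≤ codedRadius s) ∧
  ∃ v N, ∀ n, N ≤ n → ∀ z ∈ C, |z - codedCenter s| ≤ (2 * codedRadius s : ℚ) →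
    |f n z - codedRat v| - 1 / 2 ^ k ≤ 0

/-- Codes of balls such that each one is the first refinement of the one before. -/
noncomputable def refinementSeq (f : ℕ → ℝ → ℝ) (C : Set ℝ) : ℕ → ℕ
  | 0 => 0
  | k + 1 => sInf {s | IsRefinement f C k (refinementSeq f C k) s}

theorem dataDecidable_isRefinement :
    DataDecidable fun d (y : (ℕ × ℕ) × ℕ) => IsRefinement d.f d.C y.1.1 y.1.2 y.2 := by
  have hcenter {α : Type} [Primcodable α] {h : α → ℕ} (hh : Primrec h) :
      RatComputable fun _ x => codedCenter (h x) :=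
    .codedRat (.of_primrec (Primrec.fst.comp (Primrec.unpair.comp hh)))
  have hradius {α : Type} [Primcodable α] {h : α → ℕ} (hh : Primrec h) :
      RatComputable fun _ x => codedRadius (h x) :=
    .inv_two_pow (.of_primrec (Primrec.snd.comp (Primrec.unpair.comp hh)))
  have hradius₂ {α : Type} [Primcodable α] {h : α → ℕ} (hh : Primrec h) :
      RatComputable fun _ x => 2 * codedRadius (h x) :=
    ((hradius hh).add (hradius hh)).congr fun _ _ => two_mul _
  have hk : Primrec fun y : (ℕ × ℕ) × ℕ => y.1.1 := Primrec.fst.comp .fst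
  have hs₀ : Primrec fun y : (ℕ × ℕ) × ℕ => y.1.2 := Primrec.snd.comp .fst
  have hs : Primrec fun y : (ℕ × ℕ) × ℕ => y.2 := .snd
  have hgap := (hradius₂ hs₀).sub (hradius₂ hs)
  refine .and (.or (.of_primrecPred (Primrec.eq.comp hk (.const 0))) ?_)
    (.and (.of_primrecPred (Primrec.nat_le.comp (Primrec.succ.comp hk)
      (Primrec.snd.comp (Primrec.unpair.comp hs)))) (.and ?_ ?_))
  · refine ((((hcenter hs).sub (hcenter hs₀)).lt hgap).and
      (((hcenter hs).sub (hcenter hs₀)).neg.lt hgap)).of_iff fun _ _ => ?_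
    rw [← lt_sub_iff_add_lt]
    exact max_lt_iff
  · refine (DataDecidable.forall_mem_le_zero (h := fun _ _ _ => 1) (fun _ _ => continuous_const)
      ?_ (hcenter hs) (hradius hs) fun _ _ => codedRadius_pos _).not.of_iff fun _ _ => ?_
    · refine ((RatComputable.inv_two_pow (.of_primrec (Primrec.snd.comp .fst))).lt
        (.const 1)).of_iff fun d x => ?_
      rw [← Rat.cast_lt (K := ℝ), Rat.cast_one]
    · simp
  · have key := DataDecidable.forall_mem_le_zero
      (α := ((((ℕ × ℕ) × ℕ) × ℕ) × ℕ) × ℕ)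
      (h := fun d x z => |d.f x.2 z - codedRat x.1.1.2| - 1 / 2 ^ x.1.1.1.1.1)
      (c := fun _ x => codedCenter x.1.1.1.2) (ρ := fun _ x => 2 * codedRadius x.1.1.1.2)
      (fun d x => (((d.continuous_f _).sub continuous_const).abs).sub continuous_const) ?_
      (hcenter (hs.comp (Primrec.fst.comp (Primrec.fst.comp .fst))))
      (hradius₂ (hs.comp (Primrec.fst.comp (Primrec.fst.comp .fst))))
      fun _ _ => mul_pos two_pos (codedRadius_pos _)
    · exact (((DataDecidable.of_primrecPred (Primrec.nat_le.comp (Primrec.snd.comp .fst)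
        .snd)).imp key).forall_nat.exists_nat).exists_nat
    · have hx : Primrec fun y : ((((((ℕ × ℕ) × ℕ) × ℕ) × ℕ) × ℕ) × ℕ) × ℕ => y.1.1 :=
        Primrec.fst.comp .fst
      have hval := RealComputable.f.comp_primrec ((Primrec.snd.comp hx).pair .snd)
      have hv := RatComputable.codedRat (.of_primrec
        (Primrec.snd.comp (Primrec.fst.comp (Primrec.fst.comp hx))))
      have htol := (RatComputable.inv_two_pow (.of_primrec
        (hk.comp (Primrec.fst.comp (Primrec.fst.comp (Primrec.fst.comp hx)))))).add
        (RatComputable.inv_two_pow (.of_primrec (Primrec.snd.comp .fst)))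
      refine ((hval.rat_lt (hv.add htol)).or (hval.lt_rat (hv.sub htol))).of_iff fun d x => ?_
      push_cast
      rw [lt_sub_iff_add_lt, lt_abs]
      constructor <;> rintro (h | h)
      · left; linarith
      · right; linarith
      · left; linarith
      · right; linarith

theorem dataComputable_refinementSeq :
    DataComputable fun d k => refinementSeq d.f d.C k := by
  have hstep : DataComputable fun d (x : ℕ × ℕ) => sInf {s | IsRefinement d.f d.C x.1 x.2 s} :=
    dataDecidable_isRefinement.sInf
  have hrec := (DataComputable.natRec (α := ℕ) (DataComputable.of_primrec (Primrec.const 0))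
    (hstep.comp_primrec (Primrec.snd (α := ℕ)))).comp_primrec
    (h := fun k : ℕ => (k, k)) (Primrec.id.pair .id)
  convert hrec using 3 with d k
  suffices ∀ j : ℕ, refinementSeq d.f d.C j = Nat.rec 0
      (fun y u => sInf {s | IsRefinement d.f d.C y u s}) j from this k
  intro j
  induction j with
  | zero => rfl
  | succ j ih => simp only [refinementSeq, ih]

theorem IsRMCodeClosed.isClosed {a b : ℕ → ℝ} {C : Set ℝ} (hC : IsRMCodeClosed a b C) :
    IsClosed C := by
  rw [← isOpen_compl_iff, hC]
  exact isOpen_iUnion fun _ => isOpen_Ioo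

section Refinement

variable {f : ℕ → ℝ → ℝ} {g : ℝ → ℝ} {C : Set ℝ}

theorem exists_isRefinement (hf : ∀ n, Continuous (f n))
    (hlim : ∀ x, Tendsto (fun n => f n x) atTop (𝓝 (g x))) (hC : IsClosed C) {k s₀ : ℕ}
    (h : ∃ z ∈ C, k = 0 ∨ |z - codedCenter s₀| ≤ codedRadius s₀) :
    ∃ s, IsRefinement f C k s₀ s := by
  have : CompleteSpace C := hC.completeSpace_coe
  let E : ℕ × ℕ → Set C := fun p => {z | ∀ n, p.2 ≤ n → |f n z - codedRat p.1| ≤ 1 / 2 ^ k}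
  have hEc : ∀ p, IsClosed (E p) := fun p => by
    have : E p = ⋂ n, ⋂ (_ : p.2 ≤ n), {z : C | |f n z - codedRat p.1| ≤ 1 / 2 ^ k} := by
      ext; simp [E]
    rw [this]
    exact isClosed_iInter fun n => isClosed_iInter fun _ => isClosed_le
      ((((hf n).comp continuous_subtype_val).sub continuous_const).abs) continuous_const
  have hEu : ⋃ p, E p = univ := by
    refine eq_univ_of_forall fun z => mem_iUnion.2 ?_
    have hpos : (0 : ℝ) < 1 / 2 ^ k := by positivity
    obtain ⟨v, hv⟩ := exists_codedRat_near (g z) hpos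
    obtain ⟨N, hN⟩ := eventually_atTop.1 ((((hlim z).sub_const (codedRat v : ℝ)).abs).eventually_lt
      tendsto_const_nhds (by rwa [abs_sub_comm]))
    exact ⟨(v, N), fun n hn => (hN n hn).le⟩
  have hr₀ : (0 : ℝ) < codedRadius s₀ := Rat.cast_pos.2 (codedRadius_pos s₀)
  let O : Set C := {z | k = 0 ∨ |(z : ℝ) - codedCenter s₀| < 2 * codedRadius s₀}
  have hO : IsOpen O := isOpen_const.union (isOpen_lt
    ((continuous_subtype_val.sub continuous_const).abs) continuous_const)
  obtain ⟨z, hzC, hz⟩ := h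
  obtain ⟨⟨y, hyC⟩, hyO, hyE⟩ := (dense_iUnion_interior_of_closed hEc hEu).inter_open_nonempty O hO
    ⟨⟨z, hzC⟩, hz.imp_right fun h => by show |z - _| < _; linarith⟩
  obtain ⟨⟨v, N⟩, hyE⟩ := mem_iUnion.1 hyE
  obtain ⟨ρ₁, hρ₁, hball⟩ := Metric.mem_nhds_iff.1 (mem_interior_iff_mem_nhds.1 hyE)
  obtain ⟨ρ₂, hρ₂, hgap⟩ : ∃ ρ₂ > 0,
      k = 0 ∨ |y - codedCenter s₀| + ρ₂ ≤ 2 * codedRadius s₀ := by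
    rcases hyO with hk | hy
    · exact ⟨1, one_pos, Or.inl hk⟩
    · exact ⟨2 * codedRadius s₀ - |y - codedCenter s₀|, sub_pos.2 hy, Or.inr (by linarith)⟩
  obtain ⟨m, hm⟩ := exists_pow_lt_of_lt_one (show 0 < min ρ₁ ρ₂ / 3 by positivity)
    (show (1 / 2 : ℝ) < 1 by norm_num)
  have hm' : (1 : ℝ) / 2 ^ (m + (k + 1)) < min ρ₁ ρ₂ / 3 := by
    rw [← one_div_pow]
    exact (pow_le_pow_of_le_one (by norm_num) (by norm_num) (Nat.le_add_right _ _)).trans_lt hm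
  have hpos : (0 : ℝ) < 1 / 2 ^ (m + (k + 1)) := by positivity
  obtain ⟨u, hu⟩ := exists_codedRat_near y hpos
  have hmin₁ := min_le_left ρ₁ ρ₂
  have hmin₂ := min_le_right ρ₁ ρ₂
  refine ⟨Nat.pair u (m + (k + 1)), ?_⟩
  simp only [IsRefinement, codedCenter, codedRadius, Nat.unpair_pair] at hgap ⊢
  refine ⟨hgap.imp_right fun hgap => ?_, by omega, ⟨y, hyC, ?_⟩, v, N, fun n hn z hz hzu => ?_⟩
  · rw [← Rat.cast_lt (K := ℝ)]
    push_cast at hgap ⊢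
    linarith [abs_sub_le (codedRat u : ℝ) y (codedRat s₀.unpair.1)]
  · rw [abs_sub_comm]
    push_cast
    exact hu.le
  · push_cast at hzu
    refine sub_nonpos.2 ((hball ?_ : (⟨z, hz⟩ : C) ∈ E (v, N)) n hn)
    rw [Metric.mem_ball, Subtype.dist_eq, Real.dist_eq]
    show |z - y| < ρ₁
    linarith [abs_sub_le z (codedRat u) y]

theorem isRefinement_refinementSeq (hf : ∀ n, Continuous (f n))
    (hlim : ∀ x, Tendsto (fun n => f n x) atTop (𝓝 (g x))) (hC : IsClosed C) (hne : C.Nonempty)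
    (k : ℕ) : IsRefinement f C k (refinementSeq f C k) (refinementSeq f C (k + 1)) := by
  suffices h : ∃ z ∈ C, k = 0 ∨ |z - codedCenter (refinementSeq f C k)| ≤
      codedRadius (refinementSeq f C k) from
    Nat.sInf_mem (s := {s | IsRefinement f C k (refinementSeq f C k) s})
      (exists_isRefinement hf hlim hC h)
  induction k with
  | zero => exact hne.imp fun z hz => ⟨hz, Or.inl rfl⟩
  | succ k ih =>
    obtain ⟨-, -, ⟨z, hz, hz'⟩, -⟩ :=
      Nat.sInf_mem (s := {s | IsRefinement f C k (refinementSeq f C k) s})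
        (exists_isRefinement hf hlim hC ih)
    exact ⟨z, hz, Or.inr hz'⟩

/-- The centres converge to a point of `C` at which the restriction of the limit is continuous. -/
theorem exists_continuousAt_domRestrict
    (hlim : ∀ x, Tendsto (fun n => f n x) atTop (𝓝 (g x))) (hC : IsClosed C) {s : ℕ → ℕ}
    (hs : ∀ k, IsRefinement f C k (s k) (s (k + 1))) :
    ∃ x : C, ContinuousAt (C.domRestrict g) x ∧
      RepresentsReal (fun k => (s (k + 1)).unpair.1) x := by
  set c : ℕ → ℝ := fun k => (codedCenter (s (k + 1)) : ℝ) with hc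
  set r : ℕ → ℝ := fun k => (codedRadius (s (k + 1)) : ℝ) with hr
  have hr0 : ∀ k, 0 < r k := fun k => Rat.cast_pos.2 (codedRadius_pos (s (k + 1)))
  have hrk : ∀ k, 2 * r k ≤ 1 / 2 ^ k := fun k => by
    have h := (hs k).2.1
    have : r k ≤ 1 / 2 ^ (k + 1) := by
      simp only [hr, codedRadius]
      push_cast
      gcongr
      norm_num
    rw [pow_succ] at this
    have h' : (1 : ℝ) / (2 ^ k * 2) = 1 / 2 ^ k / 2 := by field_simp
    linarith
  have hnest : ∀ k, |c (k + 1) - c k| + 2 * r (k + 1) < 2 * r k := fun k => by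
    have := (Rat.cast_lt (K := ℝ)).2 ((hs (k + 1)).1.resolve_left (Nat.succ_ne_zero k))
    push_cast at this
    exact this
  have hnest' : ∀ k j, k ≤ j → |c j - c k| + 2 * r j ≤ 2 * r k := by
    intro k j hkj
    induction j, hkj using Nat.le_induction with
    | base => simp
    | succ j _ ih => linarith [hnest j, abs_sub_le (c (j + 1)) (c j) (c k)]
  have hdist : ∀ k j, k ≤ j → |c j - c k| ≤ 2 * r k := fun k j hkj => by
    linarith [hnest' k j hkj, hr0 j]
  have htend : Tendsto (fun k : ℕ => (1 : ℝ) / 2 ^ k) atTop (𝓝 0) := by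
    simpa [one_div] using tendsto_pow_atTop_nhds_zero_of_lt_one
      (show (0 : ℝ) ≤ 2⁻¹ by norm_num) (by norm_num)
  have hcauchy : CauchySeq c := by
    refine cauchySeq_of_le_tendsto_0 (fun k : ℕ => 2 * (1 / 2 ^ k)) (fun i j k hi hj => ?_)
      (by simpa using htend.const_mul 2)
    rw [Real.dist_eq]
    have := abs_sub_le (c i) (c k) (c j)
    rw [abs_sub_comm (c k)] at this
    linarith [hdist k i hi, hdist k j hj, hrk k]
  obtain ⟨x, hx⟩ := cauchySeq_tendsto_of_complete hcauchy
  have hxc : ∀ k, |x - c k| ≤ 2 * r k := fun k =>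
    le_of_tendsto ((hx.sub_const (c k)).abs)
      ((eventually_ge_atTop k).mono fun j hj => hdist k j hj)
  have hxc' : ∀ k, |x - c k| < 2 * r k := fun k => by
    linarith [hxc (k + 1), hnest k, abs_sub_le x (c (k + 1)) (c k)]
  have hxC : x ∈ C := by
    rw [← hC.closure_eq, Metric.mem_closure_iff]
    intro ε hε
    obtain ⟨k, hk⟩ := ((htend.const_mul 2).eventually_lt_const (by simpa using hε)).exists
    obtain ⟨z, hz, hz'⟩ := (hs k).2.2.1
    refine ⟨z, hz, ?_⟩
    rw [Real.dist_eq]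
    have h := abs_sub_le x (c k) z
    rw [abs_sub_comm (c k)] at h
    have hz'' : |z - c k| ≤ r k := hz'
    linarith [hxc k, hrk k, hr0 k]
  refine ⟨⟨x, hxC⟩, ?_, ⟨fun i j hij => ?_, hx⟩⟩
  · rw [Metric.continuousAt_iff]
    intro ε hε
    obtain ⟨k, hk⟩ := ((htend.const_mul 2).eventually_lt_const (by simpa using hε)).exists
    obtain ⟨v, N, hN⟩ := (hs k).2.2.2
    have hg : ∀ z ∈ C, |z - c k| ≤ 2 * r k → |g z - codedRat v| ≤ 1 / 2 ^ k := by
      intro z hz hzc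
      refine le_of_tendsto (((hlim z).sub_const _).abs) ((eventually_ge_atTop N).mono fun n hn => ?_)
      exact sub_nonpos.1 (hN n hn z hz (by push_cast; exact hzc))
    refine ⟨2 * r k - |x - c k|, sub_pos.2 (hxc' k), fun {y} hy => ?_⟩
    rw [Subtype.dist_eq, Real.dist_eq] at hy
    have h₁ := hg y y.2 (by linarith [abs_sub_le (y : ℝ) x (c k)])
    have h₂ := hg x hxC (hxc k)
    rw [abs_sub_comm] at h₂
    show |g y - g x| < ε
    linarith [abs_sub_le (g y) (codedRat v) (g x)]
  · rw [abs_sub_comm, ← Rat.cast_le (K := ℝ)]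
    push_cast
    exact (hdist i j hij).trans (hrk i)

end Refinement

theorem lemma2p3 :
    ∃ e : ℕ, ∀ (f : ℕ → ℝ → ℝ) (g : ℝ → ℝ) (C : Set ℝ) (a b : ℕ → ℝ),
      (∀ n, Continuous (f n)) →
      (∀ x, Tendsto (fun n => f n x) atTop (𝓝 (g x))) →
      C.Nonempty →
      IsRMCodeClosed a b C →
      ∃ x : C, ContinuousAt (C.domRestrict g) x ∧
        ∀ (F : (ℕ → ℕ) → ℕ) (A B : ℕ → ℕ),
          RepresentsFunSeq F f → RepresentsRealSeq A a → RepresentsRealSeq B b →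
          ∃ ξ : ℕ → ℕ, RepresentsReal ξ (x : ℝ) ∧
            ∀ k : ℕ, KleeneComputes e
              [KArg.num k, KArg.fn2 existsTwo, KArg.fn2 F, KArg.fn A, KArg.fn B] (ξ k) := by
  obtain ⟨u, ⟨e, he⟩, hu⟩ := (dataComputable_refinementSeq.comp_primrec Primrec.succ).map
    (p := fun s => s.unpair.1) (Primrec.fst.comp Primrec.unpair)
  refine ⟨e, fun f g C a b hf hlim hne hC => ?_⟩
  obtain ⟨x, hx, hξ⟩ := exists_continuousAt_domRestrict hlim hC.isClosed
    (isRefinement_refinementSeq hf hlim hC.isClosed hne)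
  refine ⟨x, hx, fun F A B hF hA hB => ⟨_, hξ, fun k => ?_⟩⟩
  let d : BaireOneData := ⟨f, g, C, a, b, F, A, B, hf, hlim, hne, hC, hF, hA, hB⟩
  have := he d k
  rwa [show u d k = _ from hu d k] at this
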